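/- Let $\Sigma_k$ be an alphabet with $k$ letters. For $p>0$, a $p$-deletion is a step $ux^pv\to uv$ with $u,v,x\in\Sigma_k^*$ and $x$ nonempty, and a word is $p$-deletable if some finite (possibly empty) sequence of $p$-deletions leads from it to the empty word $\epsilon$. Let $D_{k,p}\subseteq\Sigma_k^*$ be the language of $p$-deletable words. An indexed grammar consists of finite sets $N$ (nonterminals), $T$ (terminals), $I$ (indices), a start symbol $S\in N$ and a finite set of productions, each of one of the forms $$A[\sigma]\to\alpha[\sigma],\qquad A[\sigma]\to B[\gamma\sigma],\qquad A[\gamma\sigma]\to\alpha[\sigma],$$ where $A,B\in N$, $\gamma\in I$, $\alpha\in(N\cup T)^*$; each production may be applied for every stack $\sigma\in I^*$, and $\alpha[\sigma]$ means that every nonterminal in $\alpha$ receives the stack $\sigma$. A linear indexed grammar is defined in the same way, but with productions of the forms $$A[\sigma]\to\alpha[]\,B[\sigma]\,\beta[],\qquad A[\sigma]\to\alpha[]\,B[\gamma\sigma]\,\beta[],\qquad A[\gamma\sigma]\to\alpha[]\,B[\sigma]\,\beta[],\qquad A[]\to w,$$ where $A,B\in N$, $\gamma\in I$, $\alpha,\beta\in(N\cup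 T)^*$, $w\in T^*$, and $[]$ is the empty stack. The language generated by such a grammar is the set of words in $T^*$ derivable from $S[]$. A language is an indexed language (respectively, a linear indexed language) if it is generated by an indexed grammar (respectively, a linear indexed grammar). Then for all integers $k,p>0$ the language $D_{k,p}$ is an indexed language, and for every integer $k>0$ the language $D_{k,2}$ is a linear indexed language. -/

import Mathlib

/-- The `p`-fold repetition `x^p` of a word `x`. -/
def wordPow {α : Type*} (x : List α) (p : ℕ) : List α :=
  (List.replicate p x).flatten

/-- A single `p`-deletion `u x^p v → u v`, where `x` is a nonempty word. -/
def PDeletion {α : Type*} (p : ℕ) (w w' : List α) : Prop :=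
  ∃ u x v : List α, x ≠ [] ∧ w = u ++ wordPow x p ++ v ∧ w' = u ++ v

/-- A word is `p`-deletable if some finite (possibly empty) sequence of `p`-deletions
leads from it to the empty word. -/
def PDeletable {α : Type*} (p : ℕ) (w : List α) : Prop :=
  Relation.ReflTransGen (PDeletion p) w []

/-- The language `D_{k,p}` of `p`-deletable words over the `k`-letter alphabet `Fin k`. -/
def deletableLanguage (k p : ℕ) : Language (Fin k) :=
  {w : List (Fin k) | PDeletable p w}

/-- `α[σ]`: every nonterminal occurring in `α` receives the stack `σ` (top of stack first). -/
def withStack {T N I : Type*} (σ : List I) (α : List (Symbol T N)) :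
    List (Symbol T (N × List I)) :=
  α.map fun s => match s with
    | Symbol.terminal a => Symbol.terminal a
    | Symbol.nonterminal A => Symbol.nonterminal (A, σ)

/-- One rewriting step in a sentential form whose nonterminals carry stacks: an occurrence of a
nonterminal `A[σ]` is replaced by `β`, where `R A σ β` says that `A[σ] → β` is an instance of
some production. -/
def RewriteStep {T N I : Type*} (R : N → List I → List (Symbol T (N × List I)) → Prop)
    (x y : List (Symbol T (N × List I))) : Prop :=
  ∃ u v A σ β, R A σ β ∧ x = u ++ [Symbol.nonterminal (A, σ)] ++ v ∧ y = u ++ β ++ v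

/-- The terminal words derivable from the start symbol `S` with empty stack, when `R` lists the
production instances. -/
def derivedLanguage {T N I : Type*} (R : N → List I → List (Symbol T (N × List I)) → Prop)
    (S : N) : Language T :=
  {w : List T | Relation.ReflTransGen (RewriteStep R)
    [Symbol.nonterminal (S, [])] (w.map Symbol.terminal)}

/-- The productions of indexed grammars. -/
inductive IndexedRule (T N I : Type*) where
  /-- `A[σ] → α[σ]` -/
  | copy (A : N) (α : List (Symbol T N))
  /-- `A[σ] → B[γσ]` -/
  | push (A B : N) (γ : I)
  /-- `A[γσ] → α[σ]` -/
  | pop (A : N) (γ : I) (α : List (Symbol T N))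

/-- `r.Inst A τ β`: the rewriting `A[τ] → β` is one of the instances of the production `r`
(one instance for each stack `σ`). -/
inductive IndexedRule.Inst {T N I : Type*} :
    IndexedRule T N I → N → List I → List (Symbol T (N × List I)) → Prop
  | copy (A : N) (α : List (Symbol T N)) (σ : List I) :
      Inst (.copy A α) A σ (withStack σ α)
  | push (A B : N) (γ : I) (σ : List I) :
      Inst (.push A B γ) A σ [Symbol.nonterminal (B, γ :: σ)]
  | pop (A : N) (γ : I) (α : List (Symbol T N)) (σ : List I) :
      Inst (.pop A γ α) A (γ :: σ) (withStack σ α)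

/-- An indexed grammar with terminals `T`: finite sets of nonterminals, indices and productions,
and a start symbol. -/
structure IndexedGrammar (T : Type*) where
  N : Type
  I : Type
  finite_N : Finite N
  finite_I : Finite I
  rules : Set (IndexedRule T N I)
  finite_rules : rules.Finite
  start : N

/-- The language generated by an indexed grammar. -/
def IndexedGrammar.language {T : Type*} (G : IndexedGrammar T) : Language T :=
  derivedLanguage (fun A τ β => ∃ r ∈ G.rules, r.Inst A τ β) G.start

/-- Indexed languages (over a finite alphabet `T`). -/
def IsIndexedLanguage {T : Type*} (L : Language T) : Prop :=
  ∃ G : IndexedGrammar T, G.language = L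

/-- The productions of linear indexed grammars. -/
inductive LinearIndexedRule (T N I : Type*) where
  /-- `A[σ] → α[] B[σ] β[]` -/
  | copy (A : N) (α : List (Symbol T N)) (B : N) (β : List (Symbol T N))
  /-- `A[σ] → α[] B[γσ] β[]` -/
  | push (A : N) (γ : I) (α : List (Symbol T N)) (B : N) (β : List (Symbol T N))
  /-- `A[γσ] → α[] B[σ] β[]` -/
  | pop (A : N) (γ : I) (α : List (Symbol T N)) (B : N) (β : List (Symbol T N))
  /-- `A[] → w` -/
  | term (A : N) (w : List T)

/-- `r.Inst A τ δ`: the rewriting `A[τ] → δ` is one of the instances of the production `r`. -/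
inductive LinearIndexedRule.Inst {T N I : Type*} :
    LinearIndexedRule T N I → N → List I → List (Symbol T (N × List I)) → Prop
  | copy (A : N) (α : List (Symbol T N)) (B : N) (β : List (Symbol T N)) (σ : List I) :
      Inst (.copy A α B β) A σ
        (withStack [] α ++ [Symbol.nonterminal (B, σ)] ++ withStack [] β)
  | push (A : N) (γ : I) (α : List (Symbol T N)) (B : N) (β : List (Symbol T N)) (σ : List I) :
      Inst (.push A γ α B β) A σ
        (withStack [] α ++ [Symbol.nonterminal (B, γ :: σ)] ++ withStack [] β)
  | pop (A : N) (γ : I) (α : List (Symbol T N)) (B : N) (β : List (Symbol T N)) (σ : List I) :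
      Inst (.pop A γ α B β) A (γ :: σ)
        (withStack [] α ++ [Symbol.nonterminal (B, σ)] ++ withStack [] β)
  | term (A : N) (w : List T) :
      Inst (.term A w) A [] (w.map Symbol.terminal)

/-- A linear indexed grammar with terminals `T`: finite sets of nonterminals, indices and
productions, and a start symbol. -/
structure LinearIndexedGrammar (T : Type*) where
  N : Type
  I : Type
  finite_N : Finite N
  finite_I : Finite I
  rules : Set (LinearIndexedRule T N I)
  finite_rules : rules.Finite
  start : N

/-- The language generated by a linear indexed grammar. -/
def LinearIndexedGrammar.language {T : Type*} (G : LinearIndexedGrammar T) : Language T :=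
  derivedLanguage (fun A τ β => ∃ r ∈ G.rules, r.Inst A τ β) G.start

/-- Linear indexed languages (over a finite alphabet `T`). -/
def IsLinearIndexedLanguage {T : Type*} (L : Language T) : Prop :=
  ∃ G : LinearIndexedGrammar T, G.language = L

/-! The last deletion applied to a nonempty deletable word `w` erases the whole of some `x^p`, so
`w` reduces to `x^p`. Reductions split along concatenations, hence `w = w₁⋯w_p` with every `wᵢ`
reducing to `x = a₁⋯a_m`, and a word reduces to `x` exactly when it has the form `d₀a₁d₁⋯a_m d_m`
with all `dᵢ` deletable.

An indexed grammar follows this recursion: guess `x` on the stack, copy the stack to `p`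
nonterminals, and let each spell `x` with deletable words interleaved. For `p = 2` no copying is
needed: letters are pushed while the left half is produced from left to right, and popped while the
right half is produced from right to left.

Soundness interprets each nonterminal with its stack as a language closed under the productions
(`derivedLanguage_le`). Completeness is strong induction on length: since `x` is nonempty, each `dᵢ`
is shorter than `w`. -/

open Relation

/-! ### Factorizations of words under `p`-deletions -/

section Reductions

variable {α : Type*} {p : ℕ}

/-- `PReduces p w z`: some finite sequence of `p`-deletions leads from `w` to `z`. -/
abbrev PReduces (p : ℕ) : List α → List α → Prop :=
  ReflTransGen (PDeletion p)

theorem PDeletion.append_left {w w' : List α} (h : PDeletion p w w') (s : List α) :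
    PDeletion p (s ++ w) (s ++ w') := by
  obtain ⟨u, x, v, hx, rfl, rfl⟩ := h
  exact ⟨s ++ u, x, v, hx, by simp, by simp⟩

theorem PDeletion.append_right {w w' : List α} (h : PDeletion p w w') (s : List α) :
    PDeletion p (w ++ s) (w' ++ s) := by
  obtain ⟨u, x, v, hx, rfl, rfl⟩ := h
  exact ⟨u, x, v ++ s, hx, by simp, by simp⟩

theorem PReduces.append {w₁ z₁ w₂ z₂ : List α} (h₁ : PReduces p w₁ z₁) (h₂ : PReduces p w₂ z₂) :
    PReduces p (w₁ ++ w₂) (z₁ ++ z₂) :=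
  (ReflTransGen.lift (· ++ w₂) (fun _ _ (h : PDeletion p _ _) => h.append_right w₂) _ _ h₁).trans
    (ReflTransGen.lift (z₁ ++ ·) (fun _ _ (h : PDeletion p _ _) => h.append_left z₁) _ _ h₂)

theorem PReduces.length_le {w z : List α} (h : PReduces p w z) : z.length ≤ w.length := by
  induction h with
  | refl => exact le_rfl
  | tail _ h ih =>
    obtain ⟨u, x, v, hx, rfl, rfl⟩ := h
    simp only [List.length_append] at ih ⊢
    omega

/-- Undoing a deletion inserts `x^p` at a single point, which lies in one of the two factors. -/
theorem PDeletion.exists_append {w z₁ z₂ : List α} (h : PDeletion p w (z₁ ++ z₂)) :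
    ∃ w₁ w₂, w = w₁ ++ w₂ ∧ PReduces p w₁ z₁ ∧ PReduces p w₂ z₂ := by
  obtain ⟨u, x, v, hx, rfl, h⟩ := h
  rcases List.append_eq_append_iff.1 h with ⟨s, rfl, rfl⟩ | ⟨s, rfl, rfl⟩
  · exact ⟨z₁, s ++ wordPow x p ++ v, by simp, .refl, .single ⟨s, x, v, hx, rfl, rfl⟩⟩
  · exact ⟨u ++ wordPow x p ++ s, z₂, by simp, .single ⟨u, x, s, hx, rfl, rfl⟩, .refl⟩

theorem PReduces.exists_append {w z₁ z₂ : List α} (h : PReduces p w (z₁ ++ z₂)) :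
    ∃ w₁ w₂, w = w₁ ++ w₂ ∧ PReduces p w₁ z₁ ∧ PReduces p w₂ z₂ := by
  induction h using ReflTransGen.head_induction_on with
  | refl => exact ⟨z₁, z₂, rfl, .refl, .refl⟩
  | head h _ ih =>
    obtain ⟨w₁, w₂, rfl, h₁, h₂⟩ := ih
    obtain ⟨v₁, v₂, rfl, h₁', h₂'⟩ := h.exists_append
    exact ⟨v₁, v₂, rfl, h₁'.trans h₁, h₂'.trans h₂⟩

/-- Follow the surviving letter `a` backwards: each reinserted block lands entirely before or
entirely after it. -/
theorem PReduces.exists_of_singleton {w : List α} {a : α} (h : PReduces p w [a]) :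
    ∃ d e, w = d ++ a :: e ∧ PDeletable p d ∧ PDeletable p e := by
  induction h using ReflTransGen.head_induction_on with
  | refl => exact ⟨[], [], rfl, .refl, .refl⟩
  | head h _ ih =>
    obtain ⟨d, e, rfl, hd, he⟩ := ih
    obtain ⟨u, x, v, hx, rfl, h⟩ := h
    rcases List.append_eq_append_iff.1 h with ⟨s, rfl, h'⟩ | ⟨s, rfl, rfl⟩
    · cases s with
      | nil =>
        obtain rfl : v = a :: e := by simpa using h'.symm
        exact ⟨d ++ wordPow x p, e, by simp,
          .head ⟨d, x, [], hx, by simp, by simp⟩ hd, he⟩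
      | cons b s =>
        obtain ⟨rfl, rfl⟩ : a = b ∧ e = s ++ v := by simpa using h'
        exact ⟨d, s ++ wordPow x p ++ v, by simp, hd, .head ⟨s, x, v, hx, rfl, rfl⟩ he⟩
    · exact ⟨u ++ wordPow x p ++ s, e, by simp, .head ⟨u, x, s, hx, rfl, rfl⟩ hd, he⟩

theorem PReduces.exists_of_cons {w z : List α} {a : α} (h : PReduces p w (a :: z)) :
    ∃ d w', w = d ++ a :: w' ∧ PDeletable p d ∧ PReduces p w' z := by
  obtain ⟨w₁, w₂, rfl, h₁, h₂⟩ := PReduces.exists_append (z₁ := [a]) h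
  obtain ⟨d, e, rfl, hd, he⟩ := h₁.exists_of_singleton
  exact ⟨d, e ++ w₂, by simp, hd, PReduces.append he h₂⟩

theorem PReduces.exists_of_concat {w z : List α} {a : α} (h : PReduces p w (z ++ [a])) :
    ∃ w' e, w = w' ++ a :: e ∧ PReduces p w' z ∧ PDeletable p e := by
  obtain ⟨w₁, w₂, rfl, h₁, h₂⟩ := h.exists_append
  obtain ⟨d, e, rfl, hd, he⟩ := h₂.exists_of_singleton
  exact ⟨w₁ ++ d, e, by simp, by simpa using h₁.append hd, he⟩

theorem PReduces.exists_of_wordPow {w x : List α} {n : ℕ} (hn : 0 < n)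
    (h : PReduces p w (wordPow x n)) :
    ∃ l : List (List α), w = l.flatten ∧ l.length = n ∧ ∀ v ∈ l, PReduces p v x := by
  induction n, hn using Nat.le_induction generalizing w with
  | base => exact ⟨[w], by simp, rfl, by simpa [wordPow] using h⟩
  | succ n _ ih =>
    obtain ⟨w₁, w₂, rfl, h₁, h₂⟩ := PReduces.exists_append (z₁ := x) (z₂ := wordPow x n)
      (by simpa [wordPow, List.replicate_succ] using h)
    obtain ⟨l, rfl, rfl, hl⟩ := ih h₂
    exact ⟨w₁ :: l, by simp, by simp, by simpa using ⟨h₁, hl⟩⟩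

theorem PReduces.flatten_wordPow {x : List α} {l : List (List α)}
    (h : ∀ v ∈ l, PReduces p v x) : PReduces p l.flatten (wordPow x l.length) := by
  induction l with
  | nil => exact .refl
  | cons v l ih =>
    simp only [List.mem_cons, forall_eq_or_imp] at h
    simpa [wordPow, List.replicate_succ] using h.1.append (ih h.2)

theorem pDeletable_of_reduces_wordPow {w x : List α} (h : PReduces p w (wordPow x p)) :
    PDeletable p w := by
  -- The empty word is not a legal base for a deletion, but then `x^p` is already empty.
  rcases eq_or_ne x [] with rfl | hx
  · simpa [wordPow, PDeletable] using h
  · exact h.tail ⟨[], x, [], hx, by simp, rfl⟩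

theorem PDeletable.exists_reduces_wordPow {w : List α} (h : PDeletable p w) (hw : w ≠ []) :
    ∃ x, x ≠ [] ∧ PReduces p w (wordPow x p) := by
  rcases ReflTransGen.cases_tail h with h | ⟨z, hz, u, x, v, hx, rfl, h⟩
  · exact (hw h.symm).elim
  · obtain ⟨rfl, rfl⟩ := List.append_eq_nil_iff.1 h.symm
    exact ⟨x, hx, by simpa using hz⟩

end Reductions

/-! ### Derivations and interpretations of nonterminals -/

section Derivations

variable {T N I : Type*} {R : N → List I → List (Symbol T (N × List I)) → Prop}

/-- `Yields R β w`: the terminal word `w` is derivable from the sentential form `β`. -/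
def Yields (R : N → List I → List (Symbol T (N × List I)) → Prop)
    (β : List (Symbol T (N × List I))) (w : List T) : Prop :=
  ReflTransGen (RewriteStep R) β (w.map Symbol.terminal)

theorem RewriteStep.append_left {x y : List (Symbol T (N × List I))} (h : RewriteStep R x y)
    (s : List (Symbol T (N × List I))) : RewriteStep R (s ++ x) (s ++ y) := by
  obtain ⟨u, v, A, σ, β, hR, rfl, rfl⟩ := h
  exact ⟨s ++ u, v, A, σ, β, hR, by simp, by simp⟩

theorem RewriteStep.append_right {x y : List (Symbol T (N × List I))} (h : RewriteStep R x y)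
    (s : List (Symbol T (N × List I))) : RewriteStep R (x ++ s) (y ++ s) := by
  obtain ⟨u, v, A, σ, β, hR, rfl, rfl⟩ := h
  exact ⟨u, v ++ s, A, σ, β, hR, by simp, by simp⟩

theorem Yields.terminal (w : List T) : Yields R (w.map Symbol.terminal) w :=
  .refl

theorem Yields.append {β₁ β₂ : List (Symbol T (N × List I))} {w₁ w₂ : List T}
    (h₁ : Yields R β₁ w₁) (h₂ : Yields R β₂ w₂) : Yields R (β₁ ++ β₂) (w₁ ++ w₂) := by
  rw [Yields, List.map_append]
  exact (ReflTransGen.lift (· ++ β₂) (fun _ _ (h : RewriteStep R _ _) => h.append_right β₂) _ _ h₁).trans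
    (ReflTransGen.lift (_ ++ ·) (fun _ _ (h : RewriteStep R _ _) => h.append_left _) _ _ h₂)

theorem Yields.cons_terminal {β : List (Symbol T (N × List I))} {w : List T}
    (h : Yields R β w) (a : T) : Yields R (Symbol.terminal a :: β) (a :: w) :=
  (Yields.terminal [a]).append h

theorem Yields.replicate {s : Symbol T (N × List I)} {l : List (List T)}
    (h : ∀ w ∈ l, Yields R [s] w) : Yields R (List.replicate l.length s) l.flatten := by
  induction l with
  | nil => exact .refl
  | cons w l ih =>
    simp only [List.mem_cons, forall_eq_or_imp] at h
    exact h.1.append (ih h.2)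

theorem Yields.of_rule {A : N} {σ : List I} {β : List (Symbol T (N × List I))} {w : List T}
    (hR : R A σ β) (h : Yields R β w) : Yields R [Symbol.nonterminal (A, σ)] w :=
  .head ⟨[], [], A, σ, β, hR, rfl, by simp⟩ h

/-- The language denoted by a symbol of a sentential form when each nonterminal `A[σ]` denotes
the language `L A σ`. -/
def symbolLanguage (L : N → List I → Language T) : Symbol T (N × List I) → Language T
  | .terminal a => {[a]}
  | .nonterminal A => L A.1 A.2

/-- The language denoted by a sentential form when each nonterminal `A[σ]` denotes the language
`L A σ`. -/
def formLanguage (L : N → List I → Language T) (β : List (Symbol T (N × List I))) : Language T :=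
  (β.map (symbolLanguage L)).prod

theorem formLanguage_append (L : N → List I → Language T)
    (β₁ β₂ : List (Symbol T (N × List I))) :
    formLanguage L (β₁ ++ β₂) = formLanguage L β₁ * formLanguage L β₂ := by
  simp [formLanguage]

theorem mem_formLanguage_terminal (L : N → List I → Language T) (w : List T) :
    w ∈ formLanguage L (w.map Symbol.terminal) := by
  induction w with
  | nil => exact Set.mem_singleton _
  | cons a w ih =>
    exact Language.append_mem_mul (a := [a]) (Set.mem_singleton _) ih

/-- If an interpretation of the nonterminals as languages is closed under all productions, then
every word of the derived language lies in the interpretation of the start symbol. -/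
theorem derivedLanguage_le {L : N → List I → Language T}
    (hL : ∀ A σ β, R A σ β → formLanguage L β ≤ L A σ) (S : N) :
    derivedLanguage R S ≤ L S [] := by
  -- Each rewriting step can only shrink the language denoted by the sentential form.
  have step : ∀ x y, ReflTransGen (RewriteStep R) x y → formLanguage L y ≤ formLanguage L x := by
    intro x y h
    induction h with
    | refl => exact le_rfl
    | tail _ h ih =>
      refine le_trans ?_ ih
      obtain ⟨u, v, A, σ, β, hR, rfl, rfl⟩ := h
      simp only [formLanguage_append]
      refine mul_le_mul' (mul_le_mul' le_rfl ?_) le_rfl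
      simpa [formLanguage, symbolLanguage] using hL A σ β hR
  intro w hw
  simpa [formLanguage, symbolLanguage] using
    step _ _ hw (mem_formLanguage_terminal L w)

end Derivations

/-! ### The indexed grammar for arbitrary `p` -/

section Indexed

/-- Nonterminals of the indexed grammar for `p`-deletable words. -/
inductive DelNT
  /-- the start symbol, generating all deletable words -/
  | start
  /-- pushes the letters of a word `x` on the stack -/
  | guess
  /-- generates the words reducing to the word on the stack -/
  | expand

instance : Finite DelNT :=
  .of_surjective ![DelNT.start, .guess, .expand] (by rintro (_ | _ | _) <;> simp [Fin.exists_fin_succ])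

/-- The productions of the indexed grammar for `p`-deletable words; `none` marks the bottom of the
current word in the stack. -/
def delRules (T : Type) (p : ℕ) : Set (IndexedRule T DelNT (Option T)) :=
  {.copy .start [], .push .start .guess none,
    .copy .guess (List.replicate p (.nonterminal .expand)),
    .pop .expand none [.nonterminal .start]} ∪
  (Set.range fun a : T => .push .guess .guess (some a)) ∪
  (Set.range fun a : T => .pop .expand (some a)
    [.nonterminal .start, .terminal a, .nonterminal .expand])

/-- The indexed grammar for `p`-deletable words. -/
def delGrammar (T : Type) [Finite T] (p : ℕ) : IndexedGrammar T where
  N := DelNT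
  I := Option T
  finite_N := inferInstance
  finite_I := inferInstance
  rules := delRules T p
  finite_rules := by
    refine Set.Finite.union (Set.Finite.union ?_ (Set.finite_range _)) (Set.finite_range _)
    simp
  start := .start

variable {T : Type} {p : ℕ}

/-- The word stored in the stack above the topmost marker. -/
def topWord : List (Option T) → List T
  | some a :: σ => a :: topWord σ
  | _ => []

/-- The languages generated by the nonterminals of `delGrammar`. -/
def delInterp (p : ℕ) : DelNT → List (Option T) → Language T
  | .start, _ => {w | PDeletable p w}
  | .guess, _ => {w | PDeletable p w}
  | .expand, σ => {w | PReduces p w (topWord σ)}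

/-- `start` may inherit any leftover stack: the marker `none` it pushes hides the old letters from
`topWord`. The word guessed is immaterial, since all `p` copies of `expand` read the same one. -/
theorem delInterp_closed (A : DelNT) (σ : List (Option T)) (β)
    (h : ∃ r ∈ delRules T p, r.Inst A σ β) : formLanguage (delInterp p) β ≤ delInterp p A σ := by
  obtain ⟨r, hr, h⟩ := h
  rcases hr with ((rfl | rfl | rfl | rfl) | ⟨a, rfl⟩) | ⟨a, rfl⟩ <;> cases h <;>
    intro w hw <;> change w ∈ formLanguage _ _ at hw
  · obtain rfl : w = [] := hw
    exact ReflTransGen.refl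
  · rwa [formLanguage, List.map_singleton, List.prod_singleton] at hw
  · simp only [formLanguage, withStack, List.map_replicate, List.prod_replicate,
      symbolLanguage, Language.mem_pow] at hw
    obtain ⟨l, rfl, rfl, hl⟩ := hw
    exact pDeletable_of_reduces_wordPow (PReduces.flatten_wordPow hl)
  · rwa [withStack, formLanguage, List.map_singleton, List.map_singleton, List.prod_singleton] at hw
  · rwa [formLanguage, List.map_singleton, List.prod_singleton] at hw
  · simp only [formLanguage, withStack, List.map_cons, List.map_nil, List.prod_cons,
      List.prod_nil, mul_one, symbolLanguage] at hw
    obtain ⟨d, hd, _, ⟨_, rfl, e, he, rfl⟩, rfl⟩ := hw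
    exact PReduces.append hd (PReduces.append (ReflTransGen.refl (a := [a])) he)

/-- Peeling a letter off both `x` and `w` preserves the length bound in `hd`, so it can be passed
along the induction; for nonempty `x` it makes `d` shorter than `w`. -/
theorem delGrammar_yields_expand {x : List T} (σ : List (Option T)) {w : List T}
    (h : PReduces p w x)
    (hd : ∀ d, PDeletable p d → d.length + x.length ≤ w.length → ∀ τ,
      Yields (fun A τ β => ∃ r ∈ delRules T p, r.Inst A τ β) [.nonterminal (.start, τ)] d) :
    Yields (fun A τ β => ∃ r ∈ delRules T p, r.Inst A τ β)
      [.nonterminal (.expand, x.map some ++ none :: σ)] w := by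
  induction x generalizing w with
  | nil =>
    exact .of_rule ⟨.pop .expand none [.nonterminal .start], by simp [delRules], .pop _ _ _ _⟩
      (hd w h (by simp) σ)
  | cons a x ih =>
    obtain ⟨d, v, rfl, hd', hv⟩ := h.exists_of_cons
    have := hv.length_le
    simp only [List.length_append, List.length_cons] at hd
    refine .of_rule ⟨_, Or.inr ⟨a, rfl⟩, .pop _ _ _ _⟩ ?_
    exact (hd d hd' (by omega) _).append
      ((ih hv fun e he hle => hd e he (by omega)).cons_terminal a)

/-- The last letter of `x` is pushed first, so that `x` is read from the top in its own order. -/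
theorem delGrammar_yields_guess {x : List T} (σ : List (Option T)) {w : List T}
    (h : Yields (fun A τ β => ∃ r ∈ delRules T p, r.Inst A τ β)
      [.nonterminal (.guess, x.map some ++ σ)] w) :
    Yields (fun A τ β => ∃ r ∈ delRules T p, r.Inst A τ β) [.nonterminal (.guess, σ)] w := by
  induction x with
  | nil => exact h
  | cons a x ih => exact ih (.of_rule ⟨_, Or.inl (Or.inr ⟨a, rfl⟩), .push _ _ _ _⟩ h)

theorem delGrammar_yields_start (hp : 0 < p) {w : List T} (h : PDeletable p w)
    (σ : List (Option T)) :
    Yields (fun A τ β => ∃ r ∈ delRules T p, r.Inst A τ β) [.nonterminal (.start, σ)] w := by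
  induction hn : w.length using Nat.strong_induction_on generalizing w σ with
  | _ n ih =>
  subst hn
  rcases eq_or_ne w [] with rfl | hw
  · exact .of_rule ⟨_, by simp [delRules], .copy _ [] _⟩ (.terminal [])
  obtain ⟨x, hx, h⟩ := h.exists_reduces_wordPow hw
  obtain ⟨l, rfl, rfl, hl⟩ := h.exists_of_wordPow hp
  refine .of_rule ⟨.push .start .guess none, by simp [delRules], .push _ _ _ _⟩ ?_
  refine delGrammar_yields_guess (x := x) _ ?_
  refine .of_rule ⟨.copy .guess (List.replicate l.length (.nonterminal .expand)),
    by simp [delRules], .copy _ _ _⟩ ?_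
  rw [withStack, List.map_replicate]
  refine .replicate fun v hv => delGrammar_yields_expand σ (hl v hv) fun d hd hle τ => ?_
  have := List.length_pos_iff.2 hx
  have := (List.sublist_flatten_of_mem hv).length_le
  exact ih _ (by omega) hd τ rfl

theorem isIndexedLanguage_pDeletable [Finite T] (hp : 0 < p) :
    IsIndexedLanguage ({w : List T | PDeletable p w} : Language T) :=
  ⟨delGrammar T p, le_antisymm (derivedLanguage_le delInterp_closed DelNT.start)
    fun _ hw => delGrammar_yields_start hp hw []⟩

end Indexed

/-! ### The linear indexed grammar for squares -/

section LinearIndexed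

/-- Nonterminals of the linear indexed grammar for square-deletable words. -/
inductive SquareNT
  /-- the start symbol, generating the left half of a square while storing its letters -/
  | left
  /-- generates the words reducing to the reversal of the stack -/
  | right

instance : Finite SquareNT :=
  .of_surjective ![SquareNT.left, .right] (by rintro (_ | _) <;> simp [Fin.exists_fin_succ])

/-- The productions of the linear indexed grammar for square-deletable words. -/
def squareRules (T : Type) : Set (LinearIndexedRule T SquareNT T) :=
  {.copy .left [.nonterminal .left] .left [], .copy .left [] .right [],
    .copy .right [] .right [.nonterminal .left], .term .right []} ∪
  (Set.range fun a : T => .push .left a [.terminal a] .left []) ∪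
  (Set.range fun a : T => .pop .right a [] .right [.terminal a])

/-- The linear indexed grammar for square-deletable words. -/
def squareGrammar (T : Type) [Finite T] : LinearIndexedGrammar T where
  N := SquareNT
  I := T
  finite_N := inferInstance
  finite_I := inferInstance
  rules := squareRules T
  finite_rules := by
    refine Set.Finite.union (Set.Finite.union ?_ (Set.finite_range _)) (Set.finite_range _)
    simp
  start := .left

variable {T : Type}

/-- The languages generated by the nonterminals of `squareGrammar`. -/
def squareInterp : SquareNT → List T → Language T
  | .left, σ => {w | PDeletable 2 (σ.reverse ++ w)}
  | .right, σ => {w | PReduces 2 w σ.reverse}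

/-- The reversed stack is the left half as reduced so far. Passing from `left` to `right` fixes it
as `x`, and the remaining word must reduce to the same `x`, completing a square. -/
theorem squareInterp_closed (A : SquareNT) (σ : List T) (β)
    (h : ∃ r ∈ squareRules T, r.Inst A σ β) : formLanguage squareInterp β ≤ squareInterp A σ := by
  obtain ⟨r, hr, h⟩ := h
  rcases hr with ((rfl | rfl | rfl | rfl) | ⟨a, rfl⟩) | ⟨a, rfl⟩ <;> cases h <;>
    intro w hw <;> change w ∈ formLanguage _ _ at hw <;>
    simp only [formLanguage, withStack, List.map_cons, List.map_nil, List.prod_cons,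
      List.prod_nil, mul_one, symbolLanguage, List.append_nil, List.nil_append,
      List.cons_append] at hw
  · obtain ⟨d, hd, e, he, rfl⟩ := hw
    refine ReflTransGen.trans ?_ he
    exact PReduces.append .refl (PReduces.append (z₁ := []) hd .refl)
  · refine pDeletable_of_reduces_wordPow (x := σ.reverse) ?_
    simpa [wordPow, List.replicate_succ] using
      PReduces.append (p := 2) (.refl (a := σ.reverse)) hw
  · obtain ⟨d, hd, e, he, rfl⟩ := hw
    simpa [squareInterp] using PReduces.append (z₂ := []) hd he
  · obtain rfl : w = [] := hw
    exact ReflTransGen.refl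
  · obtain ⟨_, rfl, e, he, rfl⟩ := hw
    simpa [squareInterp] using he
  · obtain ⟨d, hd, _, rfl, rfl⟩ := hw
    simpa [squareInterp] using PReduces.append (p := 2) hd (.refl (a := [a]))

/-- The last letter of the half is on top, so letters are peeled from the right end, each with the
deletable word following it; the leading deletable word remains for the empty stack. -/
theorem squareGrammar_yields_right {σ w : List T} (h : PReduces 2 w σ.reverse)
    (hd : ∀ d, PDeletable 2 d → d.length + σ.length ≤ w.length →
      Yields (fun A τ β => ∃ r ∈ squareRules T, r.Inst A τ β) [.nonterminal (.left, [])] d) :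
    Yields (fun A τ β => ∃ r ∈ squareRules T, r.Inst A τ β) [.nonterminal (.right, σ)] w := by
  induction σ generalizing w with
  | nil =>
    refine .of_rule ⟨.copy .right [] .right [.nonterminal .left], by simp [squareRules],
      .copy _ _ _ _ _⟩ ?_
    refine Yields.append (w₁ := []) ?_ (hd w h (by simp))
    exact .of_rule ⟨.term .right [], by simp [squareRules], .term _ _⟩ (.terminal [])
  | cons a σ ih =>
    rw [List.reverse_cons] at h
    obtain ⟨v, e, rfl, hv, he⟩ := h.exists_of_concat
    have := hv.length_le
    simp only [List.length_append, List.length_cons, List.length_reverse] at hd this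
    refine .of_rule ⟨.copy .right [] .right [.nonterminal .left], by simp [squareRules],
      .copy _ _ _ _ _⟩ ?_
    rw [List.append_cons v a e]
    refine Yields.append ?_ (hd e he (by omega))
    refine .of_rule ⟨_, Or.inr ⟨a, rfl⟩, .pop _ _ _ _ _ _⟩ ?_
    exact Yields.append (w₁ := v) (ih hv fun d hd' hle => hd d hd' (by omega)) (.terminal [a])

theorem squareGrammar_yields_left {σ x w₁ w₂ : List T} (h₁ : PReduces 2 w₁ x)
    (h₂ : Yields (fun A τ β => ∃ r ∈ squareRules T, r.Inst A τ β)
      [.nonterminal (.right, x.reverse ++ σ)] w₂)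
    (hd : ∀ d, PDeletable 2 d → d.length + x.length ≤ w₁.length →
      Yields (fun A τ β => ∃ r ∈ squareRules T, r.Inst A τ β) [.nonterminal (.left, [])] d) :
    Yields (fun A τ β => ∃ r ∈ squareRules T, r.Inst A τ β)
      [.nonterminal (.left, σ)] (w₁ ++ w₂) := by
  induction x generalizing σ w₁ with
  | nil =>
    refine .of_rule ⟨.copy .left [.nonterminal .left] .left [], by simp [squareRules],
      .copy _ _ _ _ _⟩ ?_
    rw [show withStack [] [] = [] from rfl, List.append_nil]
    refine Yields.append (hd w₁ h₁ (by simp)) ?_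
    exact .of_rule ⟨.copy .left [] .right [], by simp [squareRules], .copy _ _ _ _ _⟩ h₂
  | cons a x ih =>
    obtain ⟨d, v, rfl, hd', hv⟩ := h₁.exists_of_cons
    have := hv.length_le
    simp only [List.length_append, List.length_cons] at hd
    refine .of_rule ⟨.copy .left [.nonterminal .left] .left [], by simp [squareRules],
      .copy _ _ _ _ _⟩ ?_
    rw [show withStack [] [] = [] from rfl, List.append_nil, List.append_assoc d]
    refine Yields.append (hd d hd' (by omega)) ?_
    refine .of_rule ⟨_, Or.inl (Or.inr ⟨a, rfl⟩), .push _ _ _ _ _ _⟩ ?_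
    rw [show withStack [] [] = [] from rfl, List.append_nil]
    exact (ih hv (by simpa using h₂) fun e he hle => hd e he (by omega)).cons_terminal a

theorem squareGrammar_yields_start {w : List T} (h : PDeletable 2 w) :
    Yields (fun A τ β => ∃ r ∈ squareRules T, r.Inst A τ β) [.nonterminal (.left, [])] w := by
  induction hn : w.length using Nat.strong_induction_on generalizing w with
  | _ n ih =>
  subst hn
  rcases eq_or_ne w [] with rfl | hw
  · refine .of_rule ⟨.copy .left [] .right [], by simp [squareRules], .copy _ _ _ _ _⟩ ?_
    exact .of_rule ⟨.term .right [], by simp [squareRules], .term _ _⟩ (.terminal [])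
  obtain ⟨x, hx, h⟩ := h.exists_reduces_wordPow hw
  obtain ⟨w₁, w₂, rfl, h₁, h₂⟩ := PReduces.exists_append (z₁ := x) (z₂ := x)
    (by simpa [wordPow, List.replicate_succ] using h)
  -- Nonemptiness of `x` makes the inserted deletable words strictly shorter than `w₁ ++ w₂`.
  have := List.length_pos_iff.2 hx
  have := h₁.length_le
  have := h₂.length_le
  simp only [List.length_append] at ih
  refine squareGrammar_yields_left h₁ (squareGrammar_yields_right (by simpa using h₂) ?_) ?_
  · intro d hd hle
    exact ih _ (by omega) hd rfl
  · intro d hd hle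
    exact ih _ (by omega) hd rfl

theorem isLinearIndexedLanguage_square_deletable [Finite T] :
    IsLinearIndexedLanguage ({w : List T | PDeletable 2 w} : Language T) :=
  ⟨squareGrammar T, le_antisymm (derivedLanguage_le squareInterp_closed SquareNT.left)
    fun _ hw => squareGrammar_yields_start hw⟩

end LinearIndexed

theorem corollary3p7 (k : ℕ) (hk : 0 < k) :
    (∀ p : ℕ, 0 < p → IsIndexedLanguage (deletableLanguage k p)) ∧
      IsLinearIndexedLanguage (deletableLanguage k 2) :=
  ⟨fun _ hp => isIndexedLanguage_pDeletable hp, isLinearIndexedLanguage_square_deletable⟩
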